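/- Let $p$ be a prime and let $G$ be a nontrivial finite abelian $p$-group. Write $\mathbb{Z}_m$ for the cyclic group of order $m$ and $\mathrm{Aut}(G)$ for the automorphism group of $G$. 1. If $G$ is cyclic, then $|\mathrm{Aut}(G)|/|G| = (p-1)/p$. 2. If $G \cong \mathbb{Z}_p \times \mathbb{Z}_p$, then $|\mathrm{Aut}(G)|/|G| = (p-1)^2(p+1)/p$. 3. If $G \cong \mathbb{Z}_p \times \mathbb{Z}_{p^i}$ for some integer $i > 1$, then $|\mathrm{Aut}(G)|/|G| = (p-1)^2$. 4. If $G \cong \mathbb{Z}_p \times \mathbb{Z}_p \times \mathbb{Z}_p$, then $|\mathrm{Aut}(G)|/|G| = (p-1)^3(p+1)(p^2+p+1)$. In all other cases (that is, if $G$ satisfies none of the hypotheses of 1–4), $|\mathrm{Aut}(G)|/|G|$ is an integer and is divisible by $p(p-1)^2$. -/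

import Mathlib

/-!
A finite abelian `p`-group is split as `A × ℤ/p^e`, where `p ^ e` kills `A`
(`exists_addEquiv_prod_zmod_pow`). Endomorphisms are written as block matrices
`[a, f; g, b]` with `f : ℤ/p^e → A` and `g : A → ℤ/p^e`, and those automorphisms for which `g` has
values in `p ℤ/p^e` form a subgroup, the stabilizer of `A × p ℤ/p^e`. As `ℤ/p^e` is local, `b` is
a unit for all of them, so elimination factors them uniquely into an upper unitriangular, a
diagonal and a lower unitriangular matrix (`card_blockTriangular`). Their number is therefore
`|Aut A| * p ^ (e - 1) * (p - 1) * |A| * |{g}|`, where `Hom(ℤ/p^e, A)` contributes `|A|`.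

For `A = ℤ/p` and `e > 1` every automorphism is of this form, which gives the exact value. In
general Lagrange's theorem gives a divisor of `|Aut G|`. If `e > 1` and `A` is neither trivial nor
`ℤ/p`, the factors `|{g}|` and `|Aut A|` are divisible by `p` and `p * (p - 1)` respectively; the
latter follows by applying the same divisor to a splitting of `A`. Since `|G| = |A| * p ^ e`, this
proves the divisibility (`dvd_card_addAut_prod_of_one_lt`). If `e = 1`, the group is a vector space
over `ℤ/p`, and everything is read off from the order of `GL n (ℤ/p)`; in dimension at least `4`
the last two factors of that order suffice (`dvd_card_addAut_fin_zmod_prime`).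
-/

/-! ### Transport of automorphism groups -/

theorem card_mulAut_eq_card_addAut {G H : Type*} [Group G] [AddGroup H]
    (f : G ≃* Multiplicative H) : Nat.card (MulAut G) = Nat.card (AddAut H) :=
  Nat.card_congr ((MulAut.congr f).trans (MulAutMultiplicative H)).toEquiv

theorem card_addAut_congr {H K : Type*} [AddGroup H] [AddGroup K] (f : H ≃+ K) :
    Nat.card (AddAut H) = Nat.card (AddAut K) :=
  Nat.card_congr (AddAut.congr f).toEquiv

theorem card_addAut_zmod (n : ℕ) [NeZero n] : Nat.card (AddAut (ZMod n)) = n.totient := by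
  rw [← card_mulAut_eq_card_addAut (MulEquiv.refl (Multiplicative (ZMod n))),
    IsCyclic.card_mulAut, Nat.card_congr Multiplicative.toAdd, Nat.card_zmod]

/-! ### Block decomposition of automorphisms -/

section Block

variable {p e : ℕ} {A : Type*} [AddCommGroup A]

theorem ZMod.dvd_of_not_isUnit_prime_pow (hp : p.Prime) {x : ZMod (p ^ e)} (hx : ¬ IsUnit x) :
    (p : ZMod (p ^ e)) ∣ x := by
  have : NeZero (p ^ e) := ⟨pow_ne_zero _ hp.ne_zero⟩
  rw [← ZMod.natCast_zmod_val x] at hx ⊢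
  rw [ZMod.isUnit_iff_coprime] at hx
  have h : p ∣ x.val := by
    by_contra h
    exact hx (((hp.coprime_iff_not_dvd.2 h).symm).pow_right e)
  exact Nat.cast_dvd_cast h

theorem ZMod.not_isUnit_prime_pow (hp : p.Prime) (he : e ≠ 0) : ¬ IsUnit (p : ZMod (p ^ e)) := by
  rw [ZMod.isUnit_iff_coprime, Nat.coprime_pow_right_iff (Nat.pos_of_ne_zero he)]
  simpa using hp.one_lt.ne'

theorem ZMod.addMonoidHom_apply_eq_mul {n : ℕ} (b : ZMod n →+ ZMod n) (y : ZMod n) :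
    b y = y * b 1 := by
  simpa using ZMod.map_smul b y 1

variable (p e A) in
/-- The homomorphisms `A →+ ℤ/p^e` with values in `p ℤ/p^e`, which is the maximal ideal
if `e ≠ 0`. -/
def homIntoMaximal : AddSubgroup (A →+ ZMod (p ^ e)) where
  carrier := {g | ∀ a, (p : ZMod (p ^ e)) ∣ g a}
  zero_mem' a := by simp
  add_mem' hf hg a := dvd_add (hf a) (hg a)
  neg_mem' hf a := by simpa using hf a

variable (p e A) in
/-- The automorphisms of `A × ℤ/p^e` that map the subgroup `A × p ℤ/p^e` into itself. -/
def blockTriangular [Finite A] [NeZero (p ^ e)] : AddSubgroup (AddAut (A × ZMod (p ^ e))) where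
  carrier := {φ | ∀ x, (p : ZMod (p ^ e)) ∣ x.2 → (p : ZMod (p ^ e)) ∣ (φ x).2}
  zero_mem' _ hx := hx
  add_mem' hf hg x hx := hf _ (hg x hx)
  neg_mem' {φ} hφ x hx := by
    -- By finiteness, an injective self-map of the subgroup is onto.
    let r : {x : A × ZMod (p ^ e) // (p : ZMod (p ^ e)) ∣ x.2} →
        {x : A × ZMod (p ^ e) // (p : ZMod (p ^ e)) ∣ x.2} := fun x ↦ ⟨φ x, hφ x x.2⟩
    have hr : Function.Injective r := fun x y h ↦
      Subtype.ext (φ.injective (congrArg Subtype.val h))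
    obtain ⟨y, hy⟩ := Finite.surjective_of_injective hr ⟨x, hx⟩
    have hy' : φ y = x := congrArg Subtype.val hy
    rw [← hy', AddAut.neg_apply, AddEquiv.symm_apply_apply]
    exact y.2

theorem mem_blockTriangular_iff [Finite A] [NeZero (p ^ e)] {φ : AddAut (A × ZMod (p ^ e))} :
    φ ∈ blockTriangular p e A ↔ ∀ a, (p : ZMod (p ^ e)) ∣ (φ (a, 0)).2 := by
  refine ⟨fun h a ↦ h _ (dvd_zero _), fun h x hx ↦ ?_⟩
  have hb := ZMod.addMonoidHom_apply_eq_mul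
    ((AddMonoidHom.snd A _).comp (φ.toAddMonoidHom.comp (AddMonoidHom.inr A _))) x.2
  have hx' : x = (x.1, 0) + (0, x.2) := by simp
  rw [hx', map_add, Prod.snd_add]
  refine dvd_add (h _) ?_
  simp only [AddMonoidHom.coe_comp, Function.comp_apply, AddMonoidHom.coe_snd,
    AddMonoidHom.inr_apply, AddEquiv.toAddMonoidHom_eq_coe, AddMonoidHom.coe_coe] at hb
  rw [hb]
  exact hx.mul_right _

/-- The automorphism of `A × ℤ/n` with block matrix
`[1, f; 0, 1] * [α, 0; 0, u] * [1, 0; u⁻¹ * g, 1]`. -/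
def blockAut {n : ℕ} (α : AddAut A) (u : (ZMod n)ˣ) (f : ZMod n →+ A) (g : A →+ ZMod n) :
    AddAut (A × ZMod n) where
  toFun x := (α x.1 + f (g x.1 + x.2 * u), g x.1 + x.2 * u)
  invFun z := (α.symm (z.1 - f z.2), (z.2 - g (α.symm (z.1 - f z.2))) * ↑u⁻¹)
  left_inv x := by simp
  right_inv z := by simp
  map_add' x y := by
    have h : g (x.1 + y.1) + (x.2 + y.2) * u = (g x.1 + x.2 * u) + (g y.1 + y.2 * u) := by
      rw [map_add]; ring
    simp only [Prod.fst_add, Prod.snd_add, Prod.mk_add_mk, h]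
    rw [map_add, map_add]
    congr 1
    abel

theorem blockAut_apply {n : ℕ} (α : AddAut A) (u : (ZMod n)ˣ) (f : ZMod n →+ A) (g : A →+ ZMod n)
    (x : A × ZMod n) :
    blockAut α u f g x = (α x.1 + f (g x.1 + x.2 * u), g x.1 + x.2 * u) := rfl

/-- Over the local ring `ℤ/p^e`, the lower right entry of a block triangular automorphism is
a unit: otherwise the second coordinate of every value would lie in the maximal ideal. -/
theorem isUnit_of_mem_blockTriangular (hp : p.Prime) (he : e ≠ 0) [Finite A] [NeZero (p ^ e)]
    {φ : AddAut (A × ZMod (p ^ e))} (hφ : φ ∈ blockTriangular p e A) : IsUnit (φ (0, 1)).2 := by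
  by_contra h
  have hd := ZMod.dvd_of_not_isUnit_prime_pow hp h
  obtain ⟨x, hx⟩ := φ.surjective (0, 1)
  have hb := ZMod.addMonoidHom_apply_eq_mul
    ((AddMonoidHom.snd A _).comp (φ.toAddMonoidHom.comp (AddMonoidHom.inr A _))) x.2
  simp only [AddMonoidHom.coe_comp, Function.comp_apply, AddMonoidHom.coe_snd,
    AddMonoidHom.inr_apply, AddEquiv.toAddMonoidHom_eq_coe, AddMonoidHom.coe_coe] at hb
  have hx' : x = (x.1, 0) + (0, x.2) := by simp
  have h1 : (p : ZMod (p ^ e)) ∣ (φ x).2 := by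
    rw [hx', map_add, Prod.snd_add, hb]
    exact dvd_add (mem_blockTriangular_iff.1 hφ _) (hd.mul_left _)
  rw [hx] at h1
  exact ZMod.not_isUnit_prime_pow hp he (isUnit_of_dvd_one h1)

variable (p e A) in
/-- The factors of the block decomposition of a block triangular automorphism. -/
def blockTriangularOfFactors [Finite A] [NeZero (p ^ e)]
    (x : AddAut A × (ZMod (p ^ e))ˣ × (ZMod (p ^ e) →+ A) × homIntoMaximal p e A) :
    blockTriangular p e A :=
  ⟨blockAut x.1 x.2.1 x.2.2.1 x.2.2.2.1, mem_blockTriangular_iff.2 fun a ↦ by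
    simpa [blockAut_apply] using x.2.2.2.2 a⟩

theorem blockTriangularOfFactors_injective [Finite A] [NeZero (p ^ e)] :
    Function.Injective (blockTriangularOfFactors p e A) := by
  rintro ⟨α, u, f, g, hg⟩ ⟨α', u', f', g', hg'⟩ h
  have h' : ∀ x : A × ZMod (p ^ e), blockAut α u f g x = blockAut α' u' f' g' x :=
    fun x ↦ DFunLike.congr_fun (congrArg Subtype.val h) x
  simp only [blockAut_apply, Prod.mk.injEq] at h'
  have hu : u = u' := by
    ext
    simpa using (h' (0, 1)).2
  subst hu
  have hgg : g = g' := by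
    ext a
    simpa using (h' (a, 0)).2
  subst hgg
  have hf : f = f' := by
    refine DFunLike.ext _ _ fun y ↦ ?_
    simpa using (h' (0, y * ↑u⁻¹)).1
  subst hf
  have hα : α = α' := by
    refine DFunLike.ext _ _ fun a ↦ ?_
    simpa using (h' (a, 0)).1
  subst hα
  rfl

theorem blockTriangularOfFactors_surjective (hp : p.Prime) (he : e ≠ 0) [Finite A]
    [NeZero (p ^ e)] : Function.Surjective (blockTriangularOfFactors p e A) := by
  rintro ⟨φ, hφ⟩
  obtain ⟨u, hu⟩ := isUnit_of_mem_blockTriangular hp he hφ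
  let b : ZMod (p ^ e) →+ ZMod (p ^ e) :=
    (AddMonoidHom.snd A _).comp (φ.toAddMonoidHom.comp (AddMonoidHom.inr A _))
  let g : A →+ ZMod (p ^ e) :=
    (AddMonoidHom.snd A _).comp (φ.toAddMonoidHom.comp (AddMonoidHom.inl A _))
  let f : ZMod (p ^ e) →+ A :=
    ((AddMonoidHom.fst A _).comp (φ.toAddMonoidHom.comp (AddMonoidHom.inr A _))).comp
      (AddMonoidHom.mulRight (↑u⁻¹ : ZMod (p ^ e)))
  let a : A →+ A :=
    (AddMonoidHom.fst A _).comp (φ.toAddMonoidHom.comp (AddMonoidHom.inl A _)) - f.comp g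
  have hb : ∀ y, (φ (0, y)).2 = y * u := fun y ↦
    (ZMod.addMonoidHom_apply_eq_mul b y).trans (by rw [hu]; rfl)
  have hf : ∀ y, f (y * u) = (φ (0, y)).1 := fun y ↦ by simp [f]
  have hg : ∀ x, g x = (φ (x, 0)).2 := fun x ↦ rfl
  have ha : ∀ x, a x = (φ (x, 0)).1 - f (g x) := fun x ↦ rfl
  have hφa : ∀ x : A × ZMod (p ^ e), φ x = (a x.1 + f (g x.1 + x.2 * u), g x.1 + x.2 * u) := by
    intro x
    have hx' : φ x = φ (x.1, 0) + φ (0, x.2) := by rw [← map_add]; simp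
    rw [hx']
    ext
    · simp only [Prod.fst_add, map_add, hf, ha]
      abel
    · simp only [Prod.snd_add, hb, hg]
  have hinj : Function.Injective a := by
    rw [injective_iff_map_eq_zero]
    intro x hx
    have h0 : φ (x, -(g x) * ↑u⁻¹) = 0 := by
      rw [hφa]
      simp [hx]
    have := congrArg Prod.fst ((map_eq_zero_iff φ φ.injective).1 h0)
    exact this
  refine ⟨⟨AddEquiv.ofBijective a ⟨hinj, Finite.surjective_of_injective hinj⟩, u, f, g,
    fun x ↦ mem_blockTriangular_iff.1 hφ x⟩, ?_⟩
  refine Subtype.ext (DFunLike.ext _ _ fun x ↦ ?_)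
  exact (hφa x).symm

/-- Homomorphisms from `ℤ/n` to a group killed by `n` are determined by an arbitrary image
of `1`. -/
theorem card_zmod_addMonoidHom {n : ℕ} (hA : ∀ a : A, n • a = 0) :
    Nat.card (ZMod n →+ A) = Nat.card A := by
  have : Module (ZMod n) A := AddCommGroup.zmodModule hA
  refine Nat.card_congr (Equiv.ofBijective (fun f ↦ f 1) ⟨fun f g h ↦ ?_, fun a ↦ ?_⟩)
  · refine DFunLike.ext _ _ fun y ↦ ?_
    have h' : f 1 = g 1 := h
    rw [← mul_one y, ← smul_eq_mul, ZMod.map_smul f, ZMod.map_smul g, h']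
  · exact ⟨(LinearMap.toSpanSingleton (ZMod n) A a).toAddMonoidHom, one_smul _ _⟩

theorem card_blockTriangular (hp : p.Prime) (he : e ≠ 0) [Finite A] [NeZero (p ^ e)]
    (hA : ∀ a : A, p ^ e • a = 0) :
    Nat.card (blockTriangular p e A) = Nat.card (AddAut A) * (p ^ (e - 1) * (p - 1)) *
      Nat.card A * Nat.card (homIntoMaximal p e A) := by
  rw [← Nat.card_congr (Equiv.ofBijective _
    ⟨blockTriangularOfFactors_injective, blockTriangularOfFactors_surjective hp he⟩)]
  rw [Nat.card_prod, Nat.card_prod, Nat.card_prod, card_zmod_addMonoidHom hA,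
    Nat.card_eq_fintype_card (α := (ZMod (p ^ e))ˣ), ZMod.card_units_eq_totient,
    Nat.totient_prime_pow hp (Nat.pos_of_ne_zero he)]
  ring

/-- Lagrange's theorem for the block triangular automorphisms. -/
theorem dvd_card_addAut_prod (hp : p.Prime) (he : e ≠ 0) [Finite A]
    (hA : ∀ a : A, p ^ e • a = 0) :
    Nat.card (AddAut A) * (p ^ (e - 1) * (p - 1)) * Nat.card A *
      Nat.card (homIntoMaximal p e A) ∣ Nat.card (AddAut (A × ZMod (p ^ e))) := by
  have : NeZero (p ^ e) := ⟨pow_ne_zero _ hp.ne_zero⟩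
  rw [← card_blockTriangular hp he hA]
  exact AddSubgroup.card_addSubgroup_dvd_card _

theorem card_addAut_zmod_prime_prod (hp : p.Prime) (he : 1 < e) :
    Nat.card (AddAut (ZMod p × ZMod (p ^ e))) = (p - 1) ^ 2 * p ^ (e + 1) := by
  have : NeZero (p ^ e) := ⟨pow_ne_zero _ hp.ne_zero⟩
  have : NeZero p := ⟨hp.ne_zero⟩
  have : Fact p.Prime := ⟨hp⟩
  have hpe : p ∣ p ^ e := dvd_pow_self p (by omega)
  have hAp : ∀ a : ZMod p, p • a = 0 := fun a ↦ by simp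
  -- A homomorphism from `ℤ/p` to `ℤ/p^e` cannot take unit values since `p ≠ 0` in `ℤ/p^e`.
  have hg : ∀ g : ZMod p →+ ZMod (p ^ e), ∀ a, (p : ZMod (p ^ e)) ∣ g a := by
    intro g a
    refine ZMod.dvd_of_not_isUnit_prime_pow hp fun h ↦ ?_
    have h0 : (p : ZMod (p ^ e)) * g a = 0 := by
      rw [← nsmul_eq_mul, ← map_nsmul, hAp, map_zero]
    rw [h.mul_left_eq_zero, ZMod.natCast_eq_zero_iff] at h0
    have := Nat.le_of_dvd hp.pos h0
    exact absurd this (not_le.2 (by simpa using Nat.pow_lt_pow_right hp.one_lt he))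
  have htop : blockTriangular p e (ZMod p) = ⊤ := by
    refine eq_top_iff.2 fun φ _ ↦ mem_blockTriangular_iff.2 fun a ↦ ?_
    exact hg ((AddMonoidHom.snd _ _).comp (φ.toAddMonoidHom.comp (AddMonoidHom.inl _ _))) a
  have htop' : homIntoMaximal p e (ZMod p) = ⊤ := eq_top_iff.2 fun g _ ↦ hg g
  have hcard : Nat.card (ZMod p →+ ZMod (p ^ e)) = p := by
    have h := IsAddCyclic.card_nsmulAddMonoidHom_ker (G := ZMod (p ^ e)) p
    rw [Nat.card_zmod, Nat.gcd_eq_right hpe] at h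
    rw [← card_zmod_addMonoidHom (A := (nsmulAddMonoidHom (α := ZMod (p ^ e)) p).ker) (n := p)
      fun x ↦ Subtype.ext x.2] at h
    refine Eq.trans (Nat.card_congr (Equiv.ofBijective
      (fun f : ZMod p →+ (nsmulAddMonoidHom (α := ZMod (p ^ e)) p).ker ↦
        (AddSubgroup.subtype _).comp f) ⟨fun f g hfg ↦ ?_, fun f ↦ ?_⟩)).symm h
    · exact DFunLike.ext _ _ fun x ↦ Subtype.ext (DFunLike.congr_fun hfg x)
    · refine ⟨f.codRestrict _ fun x ↦ ?_, rfl⟩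
      rw [AddMonoidHom.mem_ker, nsmulAddMonoidHom_apply, ← map_nsmul, hAp, map_zero]
  have haut : Nat.card (AddAut (ZMod p)) = p - 1 := by
    rw [card_addAut_zmod, Nat.totient_prime hp]
  have := card_blockTriangular (A := ZMod p) hp (by omega : e ≠ 0) (fun a ↦ by
    obtain ⟨k, hk⟩ := hpe
    rw [hk, mul_comm, mul_nsmul', hAp, nsmul_zero])
  rw [htop, htop', AddSubgroup.card_top, AddSubgroup.card_top, hcard, haut, Nat.card_zmod] at this
  rw [this]
  obtain ⟨k, rfl⟩ : ∃ k, e = k + 1 := ⟨e - 1, by omega⟩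
  simp only [Nat.add_sub_cancel]
  ring

end Block

/-! ### Splitting off a cyclic factor -/

section Splitting

open DirectSum

/-- A nontrivial finite abelian `p`-group has a cyclic direct factor of maximal order, that is,
one whose order kills the complement. -/
theorem exists_addEquiv_prod_zmod_pow {p : ℕ} (hp : p.Prime) (G : Type*) [AddCommGroup G]
    [Finite G] [Nontrivial G] {k : ℕ} (hG : ∀ x : G, p ^ k • x = 0) :
    ∃ (e : ℕ) (A : Type) (_ : AddCommGroup A) (_ : Finite A), e ≠ 0 ∧
      (∀ a : A, p ^ e • a = 0) ∧ Nonempty (G ≃+ A × ZMod (p ^ e)) := by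
  classical
  obtain ⟨ι, _, n, hn, ⟨f⟩⟩ := AddCommGroup.equiv_directSum_zmod_of_finite' G
  let f' : G ≃+ ∀ i, ZMod (n i) := f.trans (DirectSum.addEquivProd _)
  have hpow : ∀ i, ∃ l, n i = p ^ l := by
    intro i
    have h : p ^ k • (Pi.single i 1 : ∀ i, ZMod (n i)) = 0 := by
      rw [← f'.apply_symm_apply (Pi.single i 1), ← map_nsmul, hG, map_zero]
    have h' := congrFun h i
    rw [Pi.smul_apply, Pi.single_eq_same, nsmul_eq_mul, mul_one, Pi.zero_apply,
      ZMod.natCast_eq_zero_iff, Nat.dvd_prime_pow hp] at h'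
    exact h'.imp fun l hl ↦ hl.2
  choose l hl using hpow
  obtain rfl : n = fun i ↦ p ^ l i := funext hl
  have hne : Nonempty ι := by
    by_contra h
    rw [not_nonempty_iff] at h
    exact not_subsingleton G f'.toEquiv.subsingleton
  obtain ⟨i, -, hi⟩ := Finset.exists_max_image Finset.univ l Finset.univ_nonempty
  have : ∀ j, NeZero (p ^ l j) := fun j ↦ ⟨pow_ne_zero _ hp.ne_zero⟩
  refine ⟨l i, ∀ j : {j // j ≠ i}, ZMod (p ^ l j), inferInstance, inferInstance, ?_, ?_, ⟨?_⟩⟩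
  · intro h
    have := hn i
    simp [h] at this
  · intro a
    ext j
    rw [Pi.smul_apply, Pi.zero_apply, nsmul_eq_mul,
      (ZMod.natCast_eq_zero_iff _ _).2 (pow_dvd_pow p (hi j (Finset.mem_univ _))), zero_mul]
  · exact f'.trans (AddEquiv.trans
      { Equiv.piSplitAt i (fun j ↦ ZMod (p ^ l j)) with map_add' := fun _ _ ↦ rfl }
      AddEquiv.prodComm)

end Splitting

/-! ### Divisibility of the order of the automorphism group -/

section Divisibility

variable {p e : ℕ} {A : Type*} [AddCommGroup A]

theorem sub_one_dvd_card_addAut (hp : p.Prime) [Finite A] [Nontrivial A]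
    (hA : ∀ a : A, p ^ e • a = 0) : p - 1 ∣ Nat.card (AddAut A) := by
  obtain ⟨k, B, _, _, hk, hB, ⟨f⟩⟩ := exists_addEquiv_prod_zmod_pow hp A hA
  rw [card_addAut_congr f]
  refine dvd_trans ?_ (dvd_card_addAut_prod hp hk hB)
  exact ((((dvd_refl _).mul_left _).mul_left _).mul_right _).mul_right _

theorem prime_dvd_card_of_pow_nsmul_eq_zero (hp : p.Prime) [Finite A] [Nontrivial A]
    (hA : ∀ a : A, p ^ e • a = 0) : p ∣ Nat.card A := by
  obtain ⟨a, ha⟩ := exists_ne (0 : A)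
  obtain ⟨l, -, hl⟩ := (Nat.dvd_prime_pow hp).1 (addOrderOf_dvd_of_nsmul_eq_zero (hA a))
  have hl0 : l ≠ 0 := by
    rintro rfl
    exact ha (AddMonoid.addOrderOf_eq_one_iff.1 (by simpa using hl))
  exact (dvd_pow_self p hl0).trans (hl ▸ addOrderOf_dvd_natCard a)

/-- The only nontrivial finite abelian `p`-group without automorphisms of order `p` is `ℤ/p`. -/
theorem prime_dvd_card_addAut (hp : p.Prime) [Finite A] [Nontrivial A]
    (hA : ∀ a : A, p ^ e • a = 0) (hA' : ¬ Nonempty (A ≃+ ZMod p)) :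
    p ∣ Nat.card (AddAut A) := by
  obtain ⟨k, B, _, _, hk, hB, ⟨f⟩⟩ := exists_addEquiv_prod_zmod_pow hp A hA
  rw [card_addAut_congr f]
  refine dvd_trans ?_ (dvd_card_addAut_prod hp hk hB)
  rcases subsingleton_or_nontrivial B with h | h
  · -- Here `A` is cyclic of order `p ^ k` with `k ≥ 2`.
    have hk1 : k ≠ 1 := by
      rintro rfl
      have : Unique B := ⟨⟨0⟩, fun _ ↦ Subsingleton.elim _ _⟩
      exact hA' ⟨(f.trans AddEquiv.uniqueProd).trans
        (ZMod.ringEquivCongr (pow_one p)).toAddEquiv⟩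
    have : p ∣ p ^ (k - 1) := dvd_pow_self p (by omega)
    exact (((this.mul_right _).mul_left _).mul_right _).mul_right _
  · exact ((prime_dvd_card_of_pow_nsmul_eq_zero hp hB).mul_left _).mul_right _

theorem prime_dvd_card_homIntoMaximal (hp : p.Prime) (he : 1 < e) [Finite A] [Nontrivial A]
    {k : ℕ} (hA : ∀ a : A, p ^ k • a = 0) : p ∣ Nat.card (homIntoMaximal p e A) := by
  obtain ⟨l, B, _, _, hl, hB, ⟨f⟩⟩ := exists_addEquiv_prod_zmod_pow hp A hA
  have : Fact p.Prime := ⟨hp⟩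
  have hzero : (p : ZMod (p ^ e)) * (p : ZMod (p ^ e)) ^ (e - 1) = 0 := by
    rw [← pow_succ', Nat.sub_add_cancel he.le, ← Nat.cast_pow, ZMod.natCast_self]
  -- The composite `A → ℤ/p^l → ℤ/p → ℤ/p^e`, the last map being `1 ↦ p^(e-1)`, has order `p`.
  let i : ZMod p →+ ZMod (p ^ e) :=
    ZMod.lift p ⟨(zmultiplesHom _) ((p : ZMod (p ^ e)) ^ (e - 1)), by simpa using hzero⟩
  let r : ZMod (p ^ l) →+ ZMod p := (ZMod.castHom (dvd_pow_self p hl) (ZMod p)).toAddMonoidHom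
  let g : A →+ ZMod (p ^ e) := (i.comp r).comp ((AddMonoidHom.snd B _).comp f.toAddMonoidHom)
  have hi1 : i 1 = (p : ZMod (p ^ e)) ^ (e - 1) := by
    have := ZMod.lift_coe p ⟨(zmultiplesHom _) ((p : ZMod (p ^ e)) ^ (e - 1)), by
      simpa using hzero⟩ 1
    simpa [i] using this
  have hi : ∀ y, (p : ZMod (p ^ e)) ∣ i y := by
    intro y
    have := ZMod.natCast_zmod_val y
    rw [← this, ← mul_one ((y.val : ℕ) : ZMod p), ← nsmul_eq_mul, map_nsmul, hi1, nsmul_eq_mul]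
    exact (dvd_pow_self _ (by omega)).mul_left _
  let g' : homIntoMaximal p e A := ⟨g, fun a ↦ hi _⟩
  have hg : p • g' = 0 := by
    refine Subtype.ext (DFunLike.ext _ _ fun a ↦ ?_)
    change p • i (r (f a).2) = 0
    rw [← map_nsmul]
    simp
  have hg0 : g' ≠ 0 := by
    intro h
    have h1 : g (f.symm (0, 1)) = 0 := DFunLike.congr_fun (congrArg Subtype.val h) _
    have h2 : g (f.symm (0, 1)) = i 1 := by
      change i (r (f (f.symm (0, 1))).2) = i 1
      rw [f.apply_symm_apply]
      exact congrArg i (map_one (ZMod.castHom (dvd_pow_self p hl) (ZMod p)))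
    rw [h2, hi1, ← Nat.cast_pow, ZMod.natCast_eq_zero_iff,
      Nat.pow_dvd_pow_iff_le_right hp.one_lt] at h1
    omega
  have hord := addOrderOf_dvd_natCard g'
  rwa [addOrderOf_eq_prime hg hg0] at hord

/-- If the cyclic factor of maximal order is not of prime order, the block triangular
automorphisms already provide the required divisor. -/
theorem dvd_card_addAut_prod_of_one_lt (hp : p.Prime) (he : 1 < e) [Finite A] [Nontrivial A]
    (hA : ∀ a : A, p ^ e • a = 0) (hA' : ¬ Nonempty (A ≃+ ZMod p)) :
    p * (p - 1) ^ 2 * Nat.card (A × ZMod (p ^ e)) ∣ Nat.card (AddAut (A × ZMod (p ^ e))) := by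
  refine dvd_trans ?_ (dvd_card_addAut_prod hp (by omega) hA)
  have hcop : p.Coprime (p - 1) :=
    hp.coprime_iff_not_dvd.2 fun h ↦ by
      have h1 := hp.two_le
      have := Nat.le_of_dvd (by omega) h
      omega
  have h := mul_dvd_mul (hcop.mul_dvd_of_dvd_of_dvd (prime_dvd_card_addAut hp hA hA')
    (sub_one_dvd_card_addAut hp hA)) (prime_dvd_card_homIntoMaximal hp he hA)
  obtain ⟨k, rfl⟩ : ∃ k, e = k + 1 := ⟨e - 1, by omega⟩
  rw [Nat.card_prod, Nat.card_zmod, Nat.add_sub_cancel]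
  convert mul_dvd_mul_right h (p ^ k * (p - 1) * Nat.card A) using 1 <;> ring

end Divisibility

/-! ### Elementary abelian groups -/

section Elementary

variable {p : ℕ}

theorem card_addAut_fin_zmod_prime (hp : p.Prime) (n : ℕ) :
    Nat.card (AddAut (Fin n → ZMod p)) = ∏ i : Fin n, (p ^ n - p ^ (i : ℕ)) := by
  have : Fact p.Prime := ⟨hp⟩
  have h := Matrix.card_GL_field (𝔽 := ZMod p) n
  rw [ZMod.card] at h
  let e₁ : AddAut (Fin n → ZMod p) ≃ ((Fin n → ZMod p) ≃ₗ[ZMod p] (Fin n → ZMod p)) :=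
    { toFun := fun f ↦ f.toLinearEquiv (ZMod.map_smul f)
      invFun := fun f ↦ f.toAddEquiv
      left_inv := fun _ ↦ rfl
      right_inv := fun _ ↦ rfl }
  rw [← h, Nat.card_congr e₁,
    Nat.card_congr (LinearMap.GeneralLinearGroup.generalLinearEquiv (ZMod p) _).symm.toEquiv]
  exact Nat.card_congr (Matrix.GeneralLinearGroup.toLin (n := Fin n) (R := ZMod p)).symm.toEquiv

/-- The last two factors of `∏ i < n, (p ^ n - p ^ i)` are `p ^ (n - 2) * (p ^ 2 - 1)` and
`p ^ (n - 1) * (p - 1)`; their product suffices as soon as `2 * n - 3 ≥ n + 1`. -/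
theorem dvd_card_addAut_fin_zmod_prime (hp : p.Prime) {n : ℕ} (hn : 4 ≤ n) :
    p * (p - 1) ^ 2 * Nat.card (Fin n → ZMod p) ∣ Nat.card (AddAut (Fin n → ZMod p)) := by
  have : NeZero p := ⟨hp.ne_zero⟩
  obtain ⟨m, rfl⟩ : ∃ m, n = m + 4 := ⟨n - 4, by omega⟩
  rw [card_addAut_fin_zmod_prime hp, Nat.card_fun, Nat.card_zmod, Nat.card_fin,
    Fin.prod_univ_castSucc, Fin.prod_univ_castSucc, mul_assoc (Finset.prod _ _)]
  refine Dvd.dvd.mul_left ?_ _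
  simp only [Fin.val_castSucc, Fin.val_last]
  obtain ⟨q, rfl⟩ : ∃ q, p = q + 1 := ⟨p - 1, (Nat.sub_add_cancel hp.one_le).symm⟩
  refine ⟨(q + 1) ^ m * (q + 2), ?_⟩
  have h1 : (q + 1) ^ (m + 4) - (q + 1) ^ (m + 2) = (q + 1) ^ (m + 2) * (q * (q + 2)) := by
    rw [Nat.sub_eq_iff_eq_add (Nat.pow_le_pow_right (by omega) (by omega))]
    ring
  have h2 : (q + 1) ^ (m + 4) - (q + 1) ^ (m + 3) = (q + 1) ^ (m + 3) * q := by
    rw [Nat.sub_eq_iff_eq_add (Nat.pow_le_pow_right (by omega) (by omega))]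
    ring
  rw [h1, h2, Nat.add_sub_cancel]
  ring

theorem exists_addEquiv_fin_zmod_prime (hp : p.Prime) (G : Type*) [AddCommGroup G] [Finite G]
    (hG : ∀ x : G, p • x = 0) : ∃ n, Nonempty (G ≃+ (Fin n → ZMod p)) := by
  have : Fact p.Prime := ⟨hp⟩
  have : Module (ZMod p) G := AddCommGroup.zmodModule hG
  exact ⟨_, ⟨(Module.finBasis (ZMod p) G).equivFun.toAddEquiv⟩⟩

/-- Pairs as functions on `Fin 2`. -/
def finTwoAddEquiv (A : Type*) [AddCommGroup A] : (Fin 2 → A) ≃+ A × A :=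
  { finTwoArrowEquiv A with map_add' := fun _ _ ↦ rfl }

/-- Triples as functions on `Fin 3`. -/
def finThreeAddEquiv (A : Type*) [AddCommGroup A] : (Fin 3 → A) ≃+ A × A × A where
  toFun f := (f 0, f 1, f 2)
  invFun x := ![x.1, x.2.1, x.2.2]
  left_inv f := by ext i; fin_cases i <;> rfl
  right_inv _ := rfl
  map_add' _ _ := rfl

theorem card_addAut_zmod_prime_prod_self (hp : p.Prime) :
    (Nat.card (AddAut (ZMod p × ZMod p)) : ℚ) = ((p : ℚ) - 1) ^ 2 * (p + 1) * p := by
  rw [← card_addAut_congr (finTwoAddEquiv (ZMod p)), card_addAut_fin_zmod_prime hp,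
    Fin.prod_univ_two, Nat.cast_mul, Nat.cast_sub (Nat.pow_le_pow_right hp.pos (by simp)),
    Nat.cast_sub (Nat.pow_le_pow_right hp.pos (by simp))]
  push_cast
  simp
  ring

theorem card_addAut_zmod_prime_prod_self_prod_self (hp : p.Prime) :
    (Nat.card (AddAut (ZMod p × ZMod p × ZMod p)) : ℚ) =
      ((p : ℚ) - 1) ^ 3 * (p + 1) * ((p : ℚ) ^ 2 + p + 1) * p ^ 3 := by
  rw [← card_addAut_congr (finThreeAddEquiv (ZMod p)), card_addAut_fin_zmod_prime hp,
    Fin.prod_univ_three, Nat.cast_mul, Nat.cast_mul,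
    Nat.cast_sub (Nat.pow_le_pow_right hp.pos (by simp)),
    Nat.cast_sub (Nat.pow_le_pow_right hp.pos (by simp)),
    Nat.cast_sub (Nat.pow_le_pow_right hp.pos (by simp))]
  push_cast
  simp
  ring

end Elementary

/-! ### The ratio of the orders -/

/-- Outside the exceptional cases, `p * (p - 1) ^ 2 * |G|` divides the order of the
automorphism group. -/
theorem dvd_card_addAut_of_not_exceptional {p : ℕ} (hp : p.Prime) (G : Type*) [AddCommGroup G]
    [Finite G] [Nontrivial G] {k : ℕ} (hG : ∀ x : G, p ^ k • x = 0)
    (h₁ : ¬ IsAddCyclic G) (h₂ : ¬ Nonempty (G ≃+ ZMod p × ZMod p))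
    (h₃ : ¬ ∃ i : ℕ, 1 < i ∧ Nonempty (G ≃+ ZMod p × ZMod (p ^ i)))
    (h₄ : ¬ Nonempty (G ≃+ ZMod p × ZMod p × ZMod p)) :
    p * (p - 1) ^ 2 * Nat.card G ∣ Nat.card (AddAut G) := by
  obtain ⟨e, A, _, _, he, hA, ⟨f⟩⟩ := exists_addEquiv_prod_zmod_pow hp G hG
  rcases Nat.lt_or_ge 1 e with he1 | he1
  · have : Nontrivial A := by
      rw [← not_subsingleton_iff_nontrivial]
      intro hs
      have : Unique A := ⟨⟨0⟩, fun _ ↦ Subsingleton.elim _ _⟩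
      exact h₁ (isAddCyclic_of_surjective _ (f.trans AddEquiv.uniqueProd).symm.surjective)
    rw [card_addAut_congr f, Nat.card_congr f.toEquiv]
    refine dvd_card_addAut_prod_of_one_lt hp he1 hA fun ⟨g⟩ ↦ h₃ ⟨e, he1, ⟨?_⟩⟩
    exact f.trans (g.prodCongr (AddEquiv.refl _))
  · obtain rfl : e = 1 := by omega
    rw [pow_one] at f
    have hGp : ∀ x : G, p • x = 0 := by
      intro x
      rw [← map_eq_zero_iff f f.injective, map_nsmul]
      ext
      · simpa using hA (f x).1
      · simp
    obtain ⟨n, ⟨g⟩⟩ := exists_addEquiv_fin_zmod_prime hp G hGp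
    rw [card_addAut_congr g, Nat.card_congr g.toEquiv]
    refine dvd_card_addAut_fin_zmod_prime hp ?_
    by_contra hn
    obtain rfl | rfl | rfl | rfl : n = 0 ∨ n = 1 ∨ n = 2 ∨ n = 3 := by omega
    · exact not_subsingleton G g.toEquiv.subsingleton
    · exact h₁ (isAddCyclic_of_surjective _
        (g.trans (LinearEquiv.funUnique (Fin 1) ℕ (ZMod p)).toAddEquiv).symm.surjective)
    · exact h₂ ⟨g.trans (finTwoAddEquiv _)⟩
    · exact h₄ ⟨g.trans (finThreeAddEquiv _)⟩

theorem mainTheorem4 (p : ℕ) (hp : p.Prime) (G : Type*) [CommGroup G] [Finite G]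
    [Nontrivial G] (hG : IsPGroup p G) :
    (IsCyclic G →
      (Nat.card (MulAut G) : ℚ) / (Nat.card G : ℚ) = ((p : ℚ) - 1) / p) ∧
    (Nonempty (G ≃* Multiplicative (ZMod p × ZMod p)) →
      (Nat.card (MulAut G) : ℚ) / (Nat.card G : ℚ) = ((p : ℚ) - 1) ^ 2 * (p + 1) / p) ∧
    (∀ i : ℕ, 1 < i → Nonempty (G ≃* Multiplicative (ZMod p × ZMod (p ^ i))) →
      (Nat.card (MulAut G) : ℚ) / (Nat.card G : ℚ) = ((p : ℚ) - 1) ^ 2) ∧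
    (Nonempty (G ≃* Multiplicative (ZMod p × ZMod p × ZMod p)) →
      (Nat.card (MulAut G) : ℚ) / (Nat.card G : ℚ) =
        ((p : ℚ) - 1) ^ 3 * (p + 1) * ((p : ℚ) ^ 2 + p + 1)) ∧
    (¬ IsCyclic G →
      ¬ Nonempty (G ≃* Multiplicative (ZMod p × ZMod p)) →
      (¬ ∃ i : ℕ, 1 < i ∧ Nonempty (G ≃* Multiplicative (ZMod p × ZMod (p ^ i)))) →
      ¬ Nonempty (G ≃* Multiplicative (ZMod p × ZMod p × ZMod p)) →
      ∃ N : ℤ, (Nat.card (MulAut G) : ℚ) / (Nat.card G : ℚ) = (N : ℚ) ∧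
        (p : ℤ) * ((p : ℤ) - 1) ^ 2 ∣ N) := by
  have : Fact p.Prime := ⟨hp⟩
  have hp0 : (p : ℚ) ≠ 0 := Nat.cast_ne_zero.2 hp.ne_zero
  have hcard {H : Type} [AddGroup H] (f : G ≃* Multiplicative H) : Nat.card G = Nat.card H :=
    Nat.card_congr (f.toEquiv.trans Multiplicative.toAdd)
  obtain ⟨k, hk⟩ := IsPGroup.iff_card.1 hG
  refine ⟨fun h ↦ ?_, fun ⟨f⟩ ↦ ?_, fun i hi ⟨f⟩ ↦ ?_, fun ⟨f⟩ ↦ ?_, fun h₁ h₂ h₃ h₄ ↦ ?_⟩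
  · have hk0 : k ≠ 0 := by
      rintro rfl
      exact (Finite.one_lt_card (α := G)).ne' hk
    obtain ⟨l, rfl⟩ := Nat.exists_eq_succ_of_ne_zero hk0
    rw [IsCyclic.card_mulAut, hk, Nat.totient_prime_pow_succ hp, Nat.cast_mul,
      Nat.cast_sub hp.one_le]
    push_cast
    rw [Nat.succ_eq_add_one, pow_succ]
    field_simp
  · rw [card_mulAut_eq_card_addAut f, hcard f, card_addAut_zmod_prime_prod_self hp,
      Nat.card_prod, Nat.card_zmod]
    push_cast
    field_simp
  · rw [card_mulAut_eq_card_addAut f, hcard f, card_addAut_zmod_prime_prod hp hi,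
      Nat.card_prod, Nat.card_zmod, Nat.card_zmod]
    push_cast [Nat.cast_sub hp.one_le]
    field_simp
    ring
  · rw [card_mulAut_eq_card_addAut f, hcard f, card_addAut_zmod_prime_prod_self_prod_self hp,
      Nat.card_prod, Nat.card_prod, Nat.card_zmod]
    push_cast
    field_simp
  · have hdvd := dvd_card_addAut_of_not_exceptional hp (Additive G) (k := k)
      (fun x ↦ by
        change x.toMul ^ p ^ k = 1
        rw [← hk, pow_card_eq_one'])
      (fun h ↦ h₁ (isAddCyclic_additive_iff.1 h))
      (fun ⟨f⟩ ↦ h₂ ⟨AddEquiv.toMultiplicativeRight f⟩)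
      (fun ⟨i, hi, ⟨f⟩⟩ ↦ h₃ ⟨i, hi, ⟨AddEquiv.toMultiplicativeRight f⟩⟩)
      (fun ⟨f⟩ ↦ h₄ ⟨AddEquiv.toMultiplicativeRight f⟩)
    rw [Nat.card_congr (AddAutAdditive G).toEquiv, Nat.card_congr Additive.toMul,
      Nat.card_congr Additive.toMul] at hdvd
    obtain ⟨c, hc⟩ := hdvd
    have hG0 : (Nat.card G : ℚ) ≠ 0 := Nat.cast_ne_zero.2 Nat.card_pos.ne'
    refine ⟨(p : ℤ) * ((p : ℤ) - 1) ^ 2 * c, ?_, dvd_mul_right _ _⟩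
    rw [hc, div_eq_iff hG0]
    push_cast [Nat.cast_sub hp.one_le]
    ring
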